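/- Let $X$ be a paracompact smooth Hausdorff manifold of dimension $n$ and let $I=(0,1]$. Generalized numbers: a net $(a_\varepsilon)_{\varepsilon\in I}$ of real numbers is moderate if $|a_\varepsilon|=O(\varepsilon^{-N})$ as $\varepsilon\to0$ for some $N$, and negligible if $|a_\varepsilon|=O(\varepsilon^{m})$ for all $m$; $\widetilde{\mathbb R}$ is the ring of moderate nets modulo the ideal of negligible nets. A number $a\in\widetilde{\mathbb R}$ is strictly positive if it has a representative with $a_\varepsilon\ge\varepsilon^m$ for some $m$ and all sufficiently small $\varepsilon$. Generalized functions: a net $(u_\varepsilon)_{\varepsilon\in I}$ in $C^\infty(X)$ (real-valued) is moderate if for every compact $K\subset X$ and every linear differential operator $P$ on $X$ there is $N$ with $\sup_{K}|Pu_\varepsilon|=O(\varepsilon^{-N})$, and negligible if for all such $K,P$ and every $m$, $\sup_{K}|Pu_\varepsilon|=O(\varepsilon^{m})$; $\mathcal G(X)$ is the ring of moderate nets modulo the ideal of negligible nets. An element $f\in\mathcal G(X)$ is strictly positive if it is invertible in $\mathcal G(X)$ and for each compact $K\subset X$ it has a representative $(f_\varepsilon)_\varepsilon$ with $f_\varepsilon\ge0$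 on $K$ for all $\varepsilon$. Generalized points: $\widetilde X_c$ is the set of nets $(x_\varepsilon)_{\varepsilon\in I}$ of points of $X$ that stay in some compact set for all sufficiently small $\varepsilon$, modulo the relation $d(x_\varepsilon,y_\varepsilon)=O(\varepsilon^m)$ for all $m$, where $d$ is the distance of an arbitrary Riemannian metric on $X$ ($d=\infty$ between different components). For $u=[(u_\varepsilon)_\varepsilon]\in\mathcal G(X)$ and $x_c=[(x_\varepsilon)_\varepsilon]\in\widetilde X_c$, the point value is $u(x_c)=[(u_\varepsilon(x_\varepsilon))_\varepsilon]\in\widetilde{\mathbb R}$. **Theorem.** Let $u\in\mathcal G(X)$. The following are equivalent: 1. $u$ is invertible (resp. strictly positive) in $\mathcal G(X)$. 2. For each $x_c\in\widetilde X_c$, $u(x_c)$ is invertible (resp. strictly positive) in $\widetilde{\mathbb R}$. 3. For each representative $(u_\varepsilon)_\varepsilon$ of $u$ and each compact $K\subset X$ there are $\varepsilon_0\in I$ and $m_0\in\mathbb N$ such that for all $\varepsilon<\varepsilon_0$, $\inf_{x\in K}|u_\varepsilon(x)|>\varepsilon^{m_0}$ (resp. $\inf_{x\in K}u_\varepsilon(x)>\varepsilon^{m_0}$),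 where $\inf\emptyset=+\infty$. 4. For each representative $(u_\varepsilon)_\varepsilon$ of $u$ and each compact $K\subset X$ there is $\varepsilon_0\in I$ such that for all $x\in K$ and all $\varepsilon<\varepsilon_0$, $u_\varepsilon(x)\ne0$ (resp. $u_\varepsilon(x)>0$). -/

import Mathlib

open scoped Manifold ContDiff ENNReal Topology

noncomputable section

namespace Colombeau

/-- The index set `(0, 1]`. The limit `ε → 0` in it is the filter `Filter.atBot`. -/
abbrev Eps : Type := Set.Ioc (0 : ℝ) 1

theorem Eps.pos (ε : Eps) : (0 : ℝ) < ε := ε.2.1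

theorem Eps.le_one (ε : Eps) : (ε : ℝ) ≤ 1 := ε.2.2

theorem Eps.one_le_inv (ε : Eps) : 1 ≤ (ε : ℝ)⁻¹ := (one_le_inv₀ ε.pos).2 ε.le_one

/-! ### Growth of nets of functions on a set -/

/-- `sup_{x ∈ A} |a_ε(x)| = O(ε^{-N})` as `ε → 0`, for some `N`. -/
def ModerateOn {S : Type*} (A : Set S) (a : Eps → S → ℝ) : Prop :=
  ∃ (N : ℕ) (C : ℝ), ∀ᶠ ε : Eps in Filter.atBot, ∀ x ∈ A, |a ε x| ≤ C * ((ε : ℝ)⁻¹) ^ N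

/-- `sup_{x ∈ A} |a_ε(x)| = O(ε^m)` as `ε → 0`, for every `m`. -/
def NegligibleOn {S : Type*} (A : Set S) (a : Eps → S → ℝ) : Prop :=
  ∀ m : ℕ, ∃ C : ℝ, ∀ᶠ ε : Eps in Filter.atBot, ∀ x ∈ A, |a ε x| ≤ C * (ε : ℝ) ^ m

section Growth

variable {S : Type*} {A : Set S} {a b : Eps → S → ℝ}

theorem ModerateOn.bound (ha : ModerateOn A a) :
    ∃ (N : ℕ) (C : ℝ), 0 ≤ C ∧
      ∀ᶠ ε : Eps in Filter.atBot, ∀ x ∈ A, |a ε x| ≤ C * ((ε : ℝ)⁻¹) ^ N := by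
  obtain ⟨N, C, h⟩ := ha
  refine ⟨N, |C|, abs_nonneg C, h.mono fun ε hε x hx => (hε x hx).trans ?_⟩
  have := ε.pos
  gcongr
  exact le_abs_self C

theorem NegligibleOn.bound (ha : NegligibleOn A a) (m : ℕ) :
    ∃ C : ℝ, 0 ≤ C ∧ ∀ᶠ ε : Eps in Filter.atBot, ∀ x ∈ A, |a ε x| ≤ C * (ε : ℝ) ^ m := by
  obtain ⟨C, h⟩ := ha m
  refine ⟨|C|, abs_nonneg C, h.mono fun ε hε x hx => (hε x hx).trans ?_⟩
  have := ε.pos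
  gcongr
  exact le_abs_self C

theorem ModerateOn.add (ha : ModerateOn A a) (hb : ModerateOn A b) :
    ModerateOn A fun ε x => a ε x + b ε x := by
  obtain ⟨N, C, hC, h⟩ := ha.bound
  obtain ⟨N', C', hC', h'⟩ := hb.bound
  refine ⟨N + N', C + C', ?_⟩
  filter_upwards [h, h'] with ε h1 h2 x hx
  have e := ε.one_le_inv
  have p1 : ((ε : ℝ)⁻¹) ^ N ≤ ((ε : ℝ)⁻¹) ^ (N + N') := pow_le_pow_right₀ e (by omega)
  have p2 : ((ε : ℝ)⁻¹) ^ N' ≤ ((ε : ℝ)⁻¹) ^ (N + N') := pow_le_pow_right₀ e (by omega)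
  calc |a ε x + b ε x| ≤ |a ε x| + |b ε x| := abs_add_le _ _
    _ ≤ C * ((ε : ℝ)⁻¹) ^ N + C' * ((ε : ℝ)⁻¹) ^ N' := add_le_add (h1 x hx) (h2 x hx)
    _ ≤ C * ((ε : ℝ)⁻¹) ^ (N + N') + C' * ((ε : ℝ)⁻¹) ^ (N + N') := by gcongr
    _ = _ := by ring

theorem ModerateOn.mul (ha : ModerateOn A a) (hb : ModerateOn A b) :
    ModerateOn A fun ε x => a ε x * b ε x := by
  obtain ⟨N, C, hC, h⟩ := ha.bound
  obtain ⟨N', C', hC', h'⟩ := hb.bound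
  refine ⟨N + N', C * C', ?_⟩
  filter_upwards [h, h'] with ε h1 h2 x hx
  rw [abs_mul]
  have := ε.pos
  calc |a ε x| * |b ε x| ≤ (C * ((ε : ℝ)⁻¹) ^ N) * (C' * ((ε : ℝ)⁻¹) ^ N') := by
        gcongr
        · exact h1 x hx
        · exact h2 x hx
    _ = _ := by rw [pow_add]; ring

theorem NegligibleOn.add (ha : NegligibleOn A a) (hb : NegligibleOn A b) :
    NegligibleOn A fun ε x => a ε x + b ε x := by
  intro m
  obtain ⟨C, hC, h⟩ := ha.bound m
  obtain ⟨C', hC', h'⟩ := hb.bound m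
  refine ⟨C + C', ?_⟩
  filter_upwards [h, h'] with ε h1 h2 x hx
  calc |a ε x + b ε x| ≤ |a ε x| + |b ε x| := abs_add_le _ _
    _ ≤ C * (ε : ℝ) ^ m + C' * (ε : ℝ) ^ m := add_le_add (h1 x hx) (h2 x hx)
    _ = _ := by ring

theorem ModerateOn.mul_negligibleOn (ha : ModerateOn A a) (hb : NegligibleOn A b) :
    NegligibleOn A fun ε x => a ε x * b ε x := by
  intro m
  obtain ⟨N, C, hC, h⟩ := ha.bound
  obtain ⟨C', hC', h'⟩ := hb.bound (N + m)
  refine ⟨C * C', ?_⟩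
  filter_upwards [h, h'] with ε h1 h2 x hx
  rw [abs_mul]
  have hp := ε.pos
  calc |a ε x| * |b ε x| ≤ (C * ((ε : ℝ)⁻¹) ^ N) * (C' * (ε : ℝ) ^ (N + m)) := by
        gcongr
        · exact h1 x hx
        · exact h2 x hx
    _ = C * C' * (ε : ℝ) ^ m * (((ε : ℝ)⁻¹) * ε) ^ N := by rw [pow_add, mul_pow]; ring
    _ = _ := by rw [inv_mul_cancel₀ hp.ne', one_pow, mul_one]

theorem ModerateOn.neg (ha : ModerateOn A a) : ModerateOn A fun ε x => -a ε x := by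
  simpa only [ModerateOn, abs_neg] using ha

theorem moderateOn_of_bounded {c : S → ℝ} {M : ℝ} (hM : ∀ x ∈ A, |c x| ≤ M) :
    ModerateOn A fun _ x => c x :=
  ⟨0, M, Filter.Eventually.of_forall fun ε x hx => by simpa using hM x hx⟩

theorem negligibleOn_zero : NegligibleOn A fun _ _ => 0 :=
  fun m => ⟨0, Filter.Eventually.of_forall fun ε x hx => by simp⟩

end Growth

/-! ### Generalized numbers -/

/-- The net `a` of numbers satisfies `|a_ε| = O(ε^{-N})` for some `N`. -/
def IsModerateNum (a : Eps → ℝ) : Prop := ModerateOn (Set.univ : Set Unit) fun ε _ => a ε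

/-- The net `a` of numbers satisfies `|a_ε| = O(ε^m)` for all `m`. -/
def IsNegligibleNum (a : Eps → ℝ) : Prop := NegligibleOn (Set.univ : Set Unit) fun ε _ => a ε

/-- The ring of moderate nets of real numbers. -/
def ModerateNum : Subring (Eps → ℝ) where
  carrier := {a | IsModerateNum a}
  mul_mem' ha hb := ModerateOn.mul ha hb
  one_mem' := moderateOn_of_bounded (c := fun _ => 1) (M := 1) (by simp)
  add_mem' ha hb := ModerateOn.add ha hb
  zero_mem' := moderateOn_of_bounded (c := fun _ => 0) (M := 0) (by simp)
  neg_mem' ha := ModerateOn.neg ha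

/-- The ideal of negligible nets of real numbers. -/
def NegligibleNum : Ideal ModerateNum where
  carrier := {a | IsNegligibleNum a.1}
  add_mem' ha hb := NegligibleOn.add ha hb
  zero_mem' := negligibleOn_zero
  smul_mem' c _ ha := ModerateOn.mul_negligibleOn c.2 ha

/-- The ring `ℝ̃` of generalized real numbers. -/
abbrev GenReal : Type := ModerateNum ⧸ NegligibleNum

/-- The class of a moderate net of numbers. -/
def GenReal.mk (a : ModerateNum) : GenReal := Ideal.Quotient.mk NegligibleNum a

/-- Strict positivity in `ℝ̃`. -/
def GenReal.StrictlyPositive (c : GenReal) : Prop :=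
  ∃ a : ModerateNum, GenReal.mk a = c ∧
    ∃ (m : ℕ) (ε₀ : Eps), ∀ ε < ε₀, (ε : ℝ) ^ m ≤ a.1 ε

/-! ### The special Colombeau algebra of a manifold -/

section Algebra

variable (n : ℕ) (X : Type*) [TopologicalSpace X] [ChartedSpace (EuclideanSpace ℝ (Fin n)) X]

/-- The algebra `C^∞(X)` of smooth real functions. -/
abbrev Smooth : Type _ := C^∞⟮𝓡 n, X; ℝ⟯

/-- The algebra of linear differential operators on `X`, as operators on `C^∞(X)`: it is generated
by the multiplications by smooth functions and the smooth vector fields, that is, the derivations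
of `C^∞(X)`. -/
def DiffOp : Subalgebra ℝ (Module.End ℝ (Smooth n X)) :=
  Algebra.adjoin ℝ
    (Set.range (fun f : Smooth n X => LinearMap.mulLeft ℝ f) ∪
      Set.range (fun D : Derivation ℝ (Smooth n X) (Smooth n X) =>
        (D : Smooth n X →ₗ[ℝ] Smooth n X)))

variable {n X}

/-- Leibniz rule: `P (u v)` is a finite sum of products `(Q u) (R v)` with differential operators
`Q` and `R`. -/
theorem DiffOp.leibniz {P : Module.End ℝ (Smooth n X)} (hP : P ∈ DiffOp n X) :
    ∃ l : List (DiffOp n X × DiffOp n X), ∀ u v : Smooth n X,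
      P (u * v) = (l.map fun q => q.1.1 u * q.2.1 v).sum := by
  let Good (P : Module.End ℝ (Smooth n X)) : Prop :=
    ∃ l : List (DiffOp n X × DiffOp n X), ∀ u v : Smooth n X,
      P (u * v) = (l.map fun q => q.1.1 u * q.2.1 v).sum
  have key (l : List (DiffOp n X × DiffOp n X)) (P : Module.End ℝ (Smooth n X)) (hP : Good P) :
      ∃ l' : List (DiffOp n X × DiffOp n X), ∀ u v : Smooth n X,
        P ((l.map fun q => q.1.1 u * q.2.1 v).sum) =
          (l'.map fun q => q.1.1 u * q.2.1 v).sum := by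
    obtain ⟨k, hk⟩ := hP
    induction l with
    | nil => exact ⟨[], fun u v => by simp⟩
    | cons q l ih =>
      obtain ⟨l', hl'⟩ := ih
      refine ⟨k.map (fun r => (r.1 * q.1, r.2 * q.2)) ++ l', fun u v => ?_⟩
      rw [List.map_cons, List.sum_cons, map_add, hl', hk, List.map_append, List.sum_append,
        List.map_map]
      rfl
  change Good P
  refine Algebra.adjoin_induction ?_ ?_ ?_ ?_ hP
  · rintro _ (⟨f, rfl⟩ | ⟨D, rfl⟩)
    · refine ⟨[(⟨LinearMap.mulLeft ℝ f, Algebra.subset_adjoin (Or.inl ⟨f, rfl⟩)⟩, 1)],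
        fun u v => ?_⟩
      simp [mul_assoc]
    · refine ⟨[(⟨D, Algebra.subset_adjoin (Or.inr ⟨D, rfl⟩)⟩, 1),
        (1, ⟨D, Algebra.subset_adjoin (Or.inr ⟨D, rfl⟩)⟩)], fun u v => ?_⟩
      simp [mul_comm, add_comm]
  · intro r
    refine ⟨[(algebraMap ℝ _ r, 1)], fun u v => ?_⟩
    simp [Algebra.algebraMap_eq_smul_one]
  · rintro P Q _ _ ⟨k, hk⟩ ⟨l, hl⟩
    exact ⟨k ++ l, fun u v => by simp [hk, hl]⟩
  · rintro P Q _ _ hP ⟨l, hl⟩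
    obtain ⟨l', h⟩ := key l P hP
    exact ⟨l', fun u v => by rw [Module.End.mul_apply, hl, h]⟩

/-- A net of smooth functions is moderate if, on each compact set, each of its derivatives
is `O(ε^{-N})` for some `N`. -/
def IsModerate (u : Eps → Smooth n X) : Prop :=
  ∀ K : Set X, IsCompact K → ∀ P ∈ DiffOp n X, ModerateOn K fun ε x => P (u ε) x

/-- A net of smooth functions is negligible if, on each compact set, each of its derivatives
is `O(ε^m)` for all `m`. -/
def IsNegligible (u : Eps → Smooth n X) : Prop :=
  ∀ K : Set X, IsCompact K → ∀ P ∈ DiffOp n X, NegligibleOn K fun ε x => P (u ε) x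

theorem IsModerate.const (f : Smooth n X) : IsModerate fun _ : Eps => f := by
  intro K hK P _
  obtain ⟨M, hM⟩ := hK.exists_bound_of_continuousOn (f := fun x => P f x)
    (P f).contMDiff.continuous.continuousOn
  exact moderateOn_of_bounded (c := fun x => P f x) hM

theorem IsModerate.mul {u v : Eps → Smooth n X} (hu : IsModerate u) (hv : IsModerate v) :
    IsModerate (u * v) := by
  intro K hK P hP
  obtain ⟨l, hl⟩ := DiffOp.leibniz hP
  have (l : List (DiffOp n X × DiffOp n X)) :
      ModerateOn K fun ε x => (l.map fun q => q.1.1 (u ε) * q.2.1 (v ε)).sum x := by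
    induction l with
    | nil => exact moderateOn_of_bounded (c := fun _ => 0) (M := 0) (by simp)
    | cons q l ih =>
      exact ((hu K hK q.1.1 q.1.2).mul (hv K hK q.2.1 q.2.2)).add ih
  simpa only [Pi.mul_apply, hl] using this l

theorem IsModerate.mul_isNegligible {u v : Eps → Smooth n X} (hu : IsModerate u)
    (hv : IsNegligible v) : IsNegligible (u * v) := by
  intro K hK P hP
  obtain ⟨l, hl⟩ := DiffOp.leibniz hP
  have (l : List (DiffOp n X × DiffOp n X)) :
      NegligibleOn K fun ε x => (l.map fun q => q.1.1 (u ε) * q.2.1 (v ε)).sum x := by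
    induction l with
    | nil => exact negligibleOn_zero
    | cons q l ih =>
      exact ((hu K hK q.1.1 q.1.2).mul_negligibleOn (hv K hK q.2.1 q.2.2)).add ih
  simpa only [Pi.mul_apply, hl] using this l

variable (n X)

/-- The ring of moderate nets of smooth functions. -/
def ModerateFun : Subring (Eps → Smooth n X) where
  carrier := {u | IsModerate u}
  mul_mem' hu hv := hu.mul hv
  one_mem' := IsModerate.const 1
  add_mem' hu hv K hK P hP := by
    simp only [Pi.add_apply, map_add]
    exact (hu K hK P hP).add (hv K hK P hP)
  zero_mem' := IsModerate.const 0
  neg_mem' hu K hK P hP := by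
    simp only [Pi.neg_apply, map_neg]
    exact (hu K hK P hP).neg

/-- The ideal of negligible nets of smooth functions. -/
def NegligibleFun : Ideal (ModerateFun n X) where
  carrier := {u | IsNegligible u.1}
  add_mem' {u v} hu hv K hK P hP := by
    change NegligibleOn K fun ε x => P (u.1 ε + v.1 ε) x
    simp only [map_add]
    exact (hu K hK P hP).add (hv K hK P hP)
  zero_mem' K _ P _ := by
    change NegligibleOn K fun _ x => P 0 x
    simp only [map_zero]
    exact negligibleOn_zero
  smul_mem' c _ hu := IsModerate.mul_isNegligible c.2 hu

/-- The special Colombeau algebra `𝒢(X)`. -/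
abbrev GenFun : Type _ := ModerateFun n X ⧸ NegligibleFun n X

variable {n X}

/-- The class of a moderate net of smooth functions. -/
def GenFun.mk (u : ModerateFun n X) : GenFun n X := Ideal.Quotient.mk (NegligibleFun n X) u

/-- Strict positivity in `𝒢(X)`. -/
def GenFun.StrictlyPositive (f : GenFun n X) : Prop :=
  IsUnit f ∧ ∀ K : Set X, IsCompact K →
    ∃ u : ModerateFun n X, GenFun.mk u = f ∧ ∀ ε : Eps, ∀ x ∈ K, 0 ≤ u.1 ε x

end Algebra

/-! ### Compactly supported generalized points and point values -/

section Points

open Bundle Manifold Filter MeasureTheory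

variable {n : ℕ} {X : Type*} [TopologicalSpace X] [ChartedSpace (EuclideanSpace ℝ (Fin n)) X]
  [IsManifold (𝓡 n) ∞ X]

theorem contDiffOn_comp_extChartAt_symm (c : X) (f : Smooth n X) :
    ContDiffOn ℝ ∞ (f ∘ (extChartAt (𝓡 n) c).symm) (extChartAt (𝓡 n) c).target :=
  (f.contMDiff.comp_contMDiffOn (contMDiffOn_extChartAt_symm c)).contDiffOn

theorem differentiableAt_comp_extChartAt_symm {c : X} (f : Smooth n X) {z : X}
    (hz : z ∈ (extChartAt (𝓡 n) c).source) :
    DifferentiableAt ℝ (f ∘ (extChartAt (𝓡 n) c).symm) (extChartAt (𝓡 n) c z) :=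
  ((contDiffOn_comp_extChartAt_symm c f).differentiableOn (by simp)).differentiableAt
    ((isOpen_extChartAt_target c).mem_nhds ((extChartAt (𝓡 n) c).map_source hz))

section CoordDeriv

variable [T2Space X] {c : X} (χ : SmoothBumpFunction (𝓡 n) c) (v : EuclideanSpace ℝ (Fin n))

/-- The partial derivative of `f` in the direction `v` in the chart at `c`, cut off by a bump
function. -/
def coordFun (f : Smooth n X) : Smooth n X :=
  ⟨fun z => χ z • fderiv ℝ (f ∘ (extChartAt (𝓡 n) c).symm) (extChartAt (𝓡 n) c z) v, by
    apply χ.contMDiff_smul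
    have h1 : ContDiffOn ℝ ∞ (fun y => fderiv ℝ (f ∘ (extChartAt (𝓡 n) c).symm) y v)
        (extChartAt (𝓡 n) c).target :=
      ((contDiffOn_comp_extChartAt_symm c f).fderiv_of_isOpen (isOpen_extChartAt_target c)
        (by simp)).clm_apply contDiffOn_const
    exact h1.contMDiffOn.comp contMDiffOn_extChartAt (fun z hz =>
      (extChartAt (𝓡 n) c).map_source (by simpa using hz))⟩

theorem coordFun_apply (f : Smooth n X) (z : X) : coordFun χ v f z =
    χ z * fderiv ℝ (f ∘ (extChartAt (𝓡 n) c).symm) (extChartAt (𝓡 n) c z) v := rfl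

theorem coordFun_eq_zero (f : Smooth n X) {z : X} (hz : z ∉ (extChartAt (𝓡 n) c).source) :
    coordFun χ v f z = 0 := by
  have h0 : χ z = 0 := by
    by_contra h
    exact hz (by simpa using χ.support_subset_source h)
  rw [coordFun_apply, h0, zero_mul]

/-- The vector field on `X` given by a cut-off partial derivative, as a derivation. -/
def coordDeriv : Derivation ℝ (Smooth n X) (Smooth n X) :=
  Derivation.mk'
    { toFun := coordFun χ v
      map_add' := fun f g => by
        ext z
        rw [ContMDiffMap.coe_add, Pi.add_apply]
        by_cases hz : z ∈ (extChartAt (𝓡 n) c).source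
        · have h := fderiv_add (differentiableAt_comp_extChartAt_symm f hz)
            (differentiableAt_comp_extChartAt_symm g hz)
          have h' := congrArg (fun L : EuclideanSpace ℝ (Fin n) →L[ℝ] ℝ => χ z * L v) h
          exact h'.trans (mul_add _ _ _)
        · simp only [coordFun_eq_zero χ v _ hz, add_zero]
      map_smul' := fun r f => by
        ext z
        rw [RingHom.id_apply, ContMDiffMap.coe_smul, Pi.smul_apply]
        by_cases hz : z ∈ (extChartAt (𝓡 n) c).source
        · have h := fderiv_const_smul (differentiableAt_comp_extChartAt_symm f hz) r
          have h' := congrArg (fun L : EuclideanSpace ℝ (Fin n) →L[ℝ] ℝ => χ z * L v) h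
          exact h'.trans (mul_left_comm _ _ _)
        · simp only [coordFun_eq_zero χ v _ hz, smul_zero] }
    (fun f g => by
      ext z
      change coordFun χ v (f * g) z = f z * coordFun χ v g z + g z * coordFun χ v f z
      by_cases hz : z ∈ (extChartAt (𝓡 n) c).source
      · have h := fderiv_mul (differentiableAt_comp_extChartAt_symm f hz)
          (differentiableAt_comp_extChartAt_symm g hz)
        have h' := congrArg (fun L : EuclideanSpace ℝ (Fin n) →L[ℝ] ℝ => χ z * L v) h
        refine h'.trans ?_
        have e : (extChartAt (𝓡 n) c).symm (extChartAt (𝓡 n) c z) = z :=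
          (extChartAt (𝓡 n) c).left_inv hz
        simp only [add_apply, smul_apply, Function.comp_apply, e,
          smul_eq_mul, coordFun_apply]
        ring
      · simp only [coordFun_eq_zero χ v _ hz, mul_zero, add_zero])

theorem coordDeriv_apply (f : Smooth n X) (z : X) : coordDeriv χ v f z =
    χ z * fderiv ℝ (f ∘ (extChartAt (𝓡 n) c).symm) (extChartAt (𝓡 n) c z) v := rfl

end CoordDeriv

/-- The differential of a smooth function in terms of its partial derivatives in a chart. -/
theorem mfderiv_eq_coord {c z : X} (f : Smooth n X) (hz : z ∈ (extChartAt (𝓡 n) c).source)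
    (w : TangentSpace (𝓡 n) z) :
    (mfderiv (𝓡 n) 𝓘(ℝ, ℝ) f z w : ℝ) =
      fderiv ℝ (f ∘ (extChartAt (𝓡 n) c).symm) (extChartAt (𝓡 n) c z)
        (mfderiv (𝓡 n) 𝓘(ℝ, EuclideanSpace ℝ (Fin n)) (extChartAt (𝓡 n) c) z w) := by
  have h1 : (f : X → ℝ) =ᶠ[𝓝 z]
      ((f ∘ (extChartAt (𝓡 n) c).symm) ∘ (extChartAt (𝓡 n) c)) := by
    filter_upwards [(isOpen_extChartAt_source (I := 𝓡 n) c).mem_nhds hz] with y hy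
    simp only [Function.comp_apply, (extChartAt (𝓡 n) c).left_inv hy]
  have h2 := mfderiv_comp z
    (differentiableAt_comp_extChartAt_symm f hz).mdifferentiableAt
    (mdifferentiableAt_extChartAt (I := 𝓡 n) (x := c) (y := z) (by simpa using hz))
  rw [mfderiv_eq_fderiv] at h2
  have h3 := h1.mfderiv_eq (I := 𝓡 n) (I' := 𝓘(ℝ, ℝ))
  exact congrArg (fun L : EuclideanSpace ℝ (Fin n) →L[ℝ] ℝ => L w) (h3.trans h2)

theorem abs_clm_apply_le (L : EuclideanSpace ℝ (Fin n) →L[ℝ] ℝ) {B : ℝ}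
    (hB : ∀ i, |L (EuclideanSpace.single i 1)| ≤ B) (w : EuclideanSpace ℝ (Fin n)) :
    |L w| ≤ n * B * ‖w‖ := by
  have hw : w = ∑ i, w i • EuclideanSpace.single i (1 : ℝ) := by
    simpa using ((EuclideanSpace.basisFun (Fin n) ℝ).sum_repr w).symm
  calc |L w| = |∑ i, w i * L (EuclideanSpace.single i 1)| := by
        conv_lhs => rw [hw, map_sum]
        simp only [map_smul, smul_eq_mul]
    _ ≤ ∑ i, |w i * L (EuclideanSpace.single i 1)| := Finset.abs_sum_le_sum_abs _ _
    _ ≤ ∑ _i : Fin n, ‖w‖ * B := by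
        refine Finset.sum_le_sum fun i _ => ?_
        rw [abs_mul]
        exact mul_le_mul (PiLp.norm_apply_le w i) (hB i) (abs_nonneg _) (norm_nonneg _)
    _ = n * B * ‖w‖ := by simp; ring

section Lipschitz

variable [RiemannianBundle (fun x : X => TangentSpace (𝓡 n) x)]

attribute [local instance] normedAddCommGroupTangentSpaceVectorSpace
  normedSpaceTangentSpaceVectorSpace

set_option linter.unusedSectionVars false in
/-- A bound of the differential of a smooth function on a ball gives a Lipschitz estimate. -/
theorem abs_sub_le_of_gradient_le {f : Smooth n X} {x y : X} {c : ℝ≥0∞} {M : ENNReal} (hM' : M ≠ ⊤)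
    (hxy : riemannianEDist (𝓡 n) x y < c)
    (hM : ∀ z, riemannianEDist (𝓡 n) x z < c → ∀ w : TangentSpace (𝓡 n) z,
      ‖(mfderiv (𝓡 n) 𝓘(ℝ, ℝ) f z w : ℝ)‖ₑ ≤ M * ‖w‖ₑ) :
    ‖f y - f x‖ₑ ≤ M * riemannianEDist (𝓡 n) x y := by
  have key : ∀ r, riemannianEDist (𝓡 n) x y < r → r < c → ‖f y - f x‖ₑ ≤ M * r := by
    intro r hr hrc
    obtain ⟨γ, h0, h1, hγ, hlen, -⟩ :=
      exists_lt_locally_constant_of_riemannianEDist_lt hr zero_lt_one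
    have hball : ∀ t ∈ Set.Icc (0 : ℝ) 1, riemannianEDist (𝓡 n) x (γ t) < c := by
      intro t ht
      calc riemannianEDist (𝓡 n) x (γ t) ≤ pathELength (𝓡 n) γ 0 t :=
            riemannianEDist_le_pathELength hγ.contMDiffOn h0 rfl ht.1
        _ ≤ pathELength (𝓡 n) γ 0 1 := pathELength_mono le_rfl ht.2
        _ < r := hlen
        _ < c := hrc
    have hfγ : ContDiffOn ℝ 1 (f ∘ γ) (Set.Icc 0 1) := by
      rw [← contMDiffOn_iff_contDiffOn]
      exact ((f.contMDiff.of_le (by simp)).comp hγ).contMDiffOn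
    calc ‖f y - f x‖ₑ = ‖(f ∘ γ) 1 - (f ∘ γ) 0‖ₑ := by simp [h0, h1]
      _ ≤ ∫⁻ t in Set.Icc (0 : ℝ) 1, ‖derivWithin (f ∘ γ) (Set.Icc 0 1) t‖ₑ :=
        enorm_sub_le_lintegral_derivWithin_Icc_of_contDiffOn_Icc hfγ zero_le_one
      _ = ∫⁻ t in Set.Icc (0 : ℝ) 1,
            ‖(mfderivWithin 𝓘(ℝ, ℝ) 𝓘(ℝ, ℝ) (f ∘ γ) (Set.Icc 0 1) t (1 : ℝ) : ℝ)‖ₑ := by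
        simp_rw [← fderivWithin_derivWithin, mfderivWithin_eq_fderivWithin]
        rfl
      _ ≤ ∫⁻ t in Set.Icc (0 : ℝ) 1,
            M * ‖mfderivWithin 𝓘(ℝ, ℝ) (𝓡 n) γ (Set.Icc 0 1) t 1‖ₑ := by
        apply setLIntegral_mono' measurableSet_Icc (fun t ht => ?_)
        have h : mfderivWithin 𝓘(ℝ, ℝ) 𝓘(ℝ, ℝ) (f ∘ γ) (Set.Icc 0 1) t =
            (mfderiv (𝓡 n) 𝓘(ℝ, ℝ) f (γ t)) ∘L
              (mfderivWithin 𝓘(ℝ, ℝ) (𝓡 n) γ (Set.Icc 0 1) t) := by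
          apply mfderiv_comp_mfderivWithin
          · exact f.contMDiff.mdifferentiable (by simp) _
          · exact (hγ.mdifferentiable one_ne_zero).mdifferentiableOn _ ht
          · rw [uniqueMDiffWithinAt_iff_uniqueDiffWithinAt]
            exact uniqueDiffOn_Icc zero_lt_one _ ht
        have h' : mfderivWithin 𝓘(ℝ, ℝ) 𝓘(ℝ, ℝ) (f ∘ γ) (Set.Icc 0 1) t 1 =
            (mfderiv (𝓡 n) 𝓘(ℝ, ℝ) f (γ t))
              (mfderivWithin 𝓘(ℝ, ℝ) (𝓡 n) γ (Set.Icc 0 1) t 1) := congr($h 1)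
        exact (le_of_eq (congrArg (fun s : ℝ => ‖s‖ₑ) h')).trans (hM _ (hball t ht) _)
      _ = M * pathELength (𝓡 n) γ 0 1 := by
        rw [lintegral_const_mul' _ _ hM', pathELength_eq_lintegral_mfderivWithin_Icc]
      _ ≤ M * r := by gcongr
  have hne : (𝓝[>] riemannianEDist (𝓡 n) x y).NeBot := nhdsGT_neBot_of_exists_gt ⟨c, hxy⟩
  have ht : Tendsto (fun r => M * r) (𝓝[>] riemannianEDist (𝓡 n) x y)
      (𝓝 (M * riemannianEDist (𝓡 n) x y)) :=
    (ENNReal.Tendsto.const_mul tendsto_id (Or.inr hM')).mono_left nhdsWithin_le_nhds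
  refine ge_of_tendsto ht ?_
  filter_upwards [Ioo_mem_nhdsGT hxy] with r hr using key r hr.1 hr.2

/-- Near each point, smooth functions are Lipschitz for the Riemannian distance, with a constant
controlled by finitely many of their derivatives. -/
theorem exists_lipschitz
    [IsContinuousRiemannianBundle (EuclideanSpace ℝ (Fin n)) (fun x : X => TangentSpace (𝓡 n) x)]
    [T2Space X] [LocallyCompactSpace X] [RegularSpace X] (c : X) :
    ∃ (K : Set X) (δ : ℝ≥0∞) (C : ℝ) (D : Fin n → Derivation ℝ (Smooth n X) (Smooth n X)),
      IsCompact K ∧ 0 < δ ∧ 0 ≤ C ∧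
      ∀ (f : Smooth n X) (B : ℝ), (∀ i, ∀ z ∈ K, |D i f z| ≤ B) →
        ∀ x y, riemannianEDist (𝓡 n) c x < δ → riemannianEDist (𝓡 n) x y < δ →
          ENNReal.ofReal |f y - f x| ≤ ENNReal.ofReal (C * B) * riemannianEDist (𝓡 n) x y := by
  obtain ⟨C, -, hC⟩ := eventually_enorm_mfderiv_extChartAt_lt (𝓡 n) c
  let χ : SmoothBumpFunction (𝓡 n) c := Classical.arbitrary _
  obtain ⟨K, hKc, hKs, hK⟩ := local_compact_nhds
    (inter_mem (inter_mem hC χ.eventuallyEq_one) (extChartAt_source_mem_nhds (I := 𝓡 n) c))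
  obtain ⟨δ, hδ, hδK⟩ := setOfPred_riemannianEDist_lt_subset_nhds' (𝓡 n) hKc
  refine ⟨K, δ / 2, n * C, fun i => coordDeriv χ (EuclideanSpace.single i 1), hK,
    ENNReal.half_pos hδ.ne', by positivity, fun f B hB x y hx hxy => ?_⟩
  rw [← Real.enorm_eq_ofReal_abs]
  refine abs_sub_le_of_gradient_le ENNReal.ofReal_ne_top hxy fun z hz w => ?_
  have hzK : z ∈ K := by
    apply hδK
    calc riemannianEDist (𝓡 n) c z
        ≤ riemannianEDist (𝓡 n) c x + riemannianEDist (𝓡 n) x z := riemannianEDist_triangle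
      _ < δ / 2 + δ / 2 := ENNReal.add_lt_add hx hz
      _ = δ := ENNReal.add_halves δ
  obtain ⟨⟨hz1, hz2⟩, hz3⟩ := hKs hzK
  have hle : ‖(mfderiv (𝓡 n) 𝓘(ℝ, EuclideanSpace ℝ (Fin n)) (extChartAt (𝓡 n) c) z w :
      EuclideanSpace ℝ (Fin n))‖ₑ ≤ C * ‖w‖ₑ :=
    (ContinuousLinearMap.le_opENorm _ _).trans (mul_le_mul_left (le_of_lt hz1) _)
  have hcoord : ∀ i, |fderiv ℝ (f ∘ (extChartAt (𝓡 n) c).symm) (extChartAt (𝓡 n) c z)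
      (EuclideanSpace.single i 1)| ≤ B := by
    intro i
    have := hB i z hzK
    rwa [coordDeriv_apply, show χ z = 1 from hz2, one_mul] at this
  obtain ⟨w', hle', e⟩ : ∃ w' : EuclideanSpace ℝ (Fin n), ‖w'‖ₑ ≤ C * ‖w‖ₑ ∧
      (mfderiv (𝓡 n) 𝓘(ℝ, ℝ) f z w : ℝ) =
        fderiv ℝ (f ∘ (extChartAt (𝓡 n) c).symm) (extChartAt (𝓡 n) c z) w' :=
    ⟨_, hle, mfderiv_eq_coord f hz3 w⟩
  have h := abs_clm_apply_le _ hcoord w'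
  rw [← e] at h
  refine (Real.enorm_eq_ofReal_abs _).trans_le ((ENNReal.ofReal_le_ofReal h).trans ?_)
  rw [ENNReal.ofReal_mul' (norm_nonneg _), ofReal_norm]
  refine (mul_le_mul_right hle' _).trans (le_of_eq ?_)
  rw [← mul_assoc, mul_right_comm (n : ℝ) (C : ℝ) B, ENNReal.ofReal_mul' (NNReal.coe_nonneg C),
    ENNReal.ofReal_coe_nnreal]

end Lipschitz

variable (n X) in
/-- Smooth Riemannian metrics on `X`. -/
abbrev SmoothMetric : Type _ :=
  ContMDiffRiemannianMetric (𝓡 n) ∞ (EuclideanSpace ℝ (Fin n))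
    (fun x : X => TangentSpace (𝓡 n) x)

/-- The distance of a Riemannian metric: the infimum of the lengths of `C^1` paths between the two
points (so `⊤` for points in different components). -/
def riemDist (g : SmoothMetric n X) (x y : X) : ℝ≥0∞ :=
  letI : RiemannianBundle (fun x : X => TangentSpace (𝓡 n) x) := ⟨g.toRiemannianMetric⟩
  riemannianEDist (𝓡 n) x y

theorem riemDist_self (g : SmoothMetric n X) (x : X) : riemDist g x x = 0 :=
  letI : RiemannianBundle (fun x : X => TangentSpace (𝓡 n) x) := ⟨g.toRiemannianMetric⟩
  riemannianEDist_self

theorem riemDist_comm (g : SmoothMetric n X) (x y : X) : riemDist g x y = riemDist g y x :=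
  letI : RiemannianBundle (fun x : X => TangentSpace (𝓡 n) x) := ⟨g.toRiemannianMetric⟩
  riemannianEDist_comm

theorem riemDist_triangle (g : SmoothMetric n X) (x y z : X) :
    riemDist g x z ≤ riemDist g x y + riemDist g y z :=
  letI : RiemannianBundle (fun x : X => TangentSpace (𝓡 n) x) := ⟨g.toRiemannianMetric⟩
  riemannianEDist_triangle

variable (X) in
/-- Compactly supported nets of points: `x_ε` stays in a compact set for small `ε`. -/
def CompactNet : Type _ :=
  {x : Eps → X // ∃ K : Set X, IsCompact K ∧ ∃ ε₀ : Eps, ∀ ε < ε₀, x ε ∈ K}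

theorem CompactNet.eventually (x : CompactNet X) :
    ∃ K : Set X, IsCompact K ∧ ∀ᶠ ε : Eps in atBot, x.1 ε ∈ K := by
  obtain ⟨K, hK, ε₀, h⟩ := x.2
  have hpos : (0 : ℝ) < ε₀ / 2 := half_pos ε₀.pos
  refine ⟨K, hK, eventually_atBot.2 ⟨⟨ε₀ / 2, hpos, by linarith [ε₀.le_one]⟩, fun ε hε => h ε ?_⟩⟩
  have h1 : (ε : ℝ) ≤ ε₀ / 2 := hε
  have h2 := ε₀.pos
  exact Subtype.coe_lt_coe.1 (by linarith)

/-- Two compactly supported nets of points are equivalent if `d(x_ε, y_ε) = O(ε^m)` for all `m`,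
where `d` is the distance of the Riemannian metric `g`. -/
def pointSetoid (g : SmoothMetric n X) : Setoid (CompactNet X) where
  r x y := ∀ m : ℕ, ∃ C : ℝ, ∀ᶠ ε : Eps in atBot,
    riemDist g (x.1 ε) (y.1 ε) ≤ ENNReal.ofReal (C * (ε : ℝ) ^ m)
  iseqv :=
    { refl := fun x m => ⟨0, Eventually.of_forall fun ε => by simp [riemDist_self]⟩
      symm := fun h m => by
        obtain ⟨C, hC⟩ := h m
        exact ⟨C, hC.mono fun ε hε => by rwa [riemDist_comm]⟩
      trans := fun h h' m => by
        obtain ⟨C, hC⟩ := h m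
        obtain ⟨C', hC'⟩ := h' m
        refine ⟨|C| + |C'|, ?_⟩
        filter_upwards [hC, hC'] with ε h1 h2
        have hε := ε.pos
        refine (riemDist_triangle g _ _ _).trans ((add_le_add h1 h2).trans ?_)
        rw [add_mul, ENNReal.ofReal_add (by positivity) (by positivity)]
        gcongr <;> exact le_abs_self _ }

/-- The set `X̃_c` of compactly supported generalized points. -/
def GenPoint (g : SmoothMetric n X) : Type _ := Quotient (pointSetoid g)

/-- The net of numbers `u_ε(x_ε)`. -/
def netValue (u : ModerateFun n X) (x : CompactNet X) : ModerateNum :=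
  ⟨fun ε => u.1 ε (x.1 ε), by
    obtain ⟨K, hK, hx⟩ := x.eventually
    obtain ⟨N, C, hC⟩ := u.2 K hK 1 (one_mem _)
    exact ⟨N, C, by filter_upwards [hx, hC] with ε h1 h2 _ _ using h2 _ h1⟩⟩

set_option linter.unusedSectionVars false in
theorem netValue_congr_left {u v : ModerateFun n X} (huv : u - v ∈ NegligibleFun n X)
    (x : CompactNet X) : GenReal.mk (netValue u x) = GenReal.mk (netValue v x) := by
  refine Ideal.Quotient.eq.2 fun m => ?_
  obtain ⟨K, hK, hx⟩ := x.eventually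
  obtain ⟨C, hC⟩ := huv K hK 1 (one_mem _) m
  exact ⟨C, by filter_upwards [hx, hC] with ε h1 h2 _ _ using h2 _ h1⟩

theorem netValue_congr_right [T2Space X] [ParacompactSpace X] (g : SmoothMetric n X)
    (u : ModerateFun n X) {x y : CompactNet X} (hxy : (pointSetoid g).r x y) :
    GenReal.mk (netValue u x) = GenReal.mk (netValue u y) := by
  let _ : RiemannianBundle (fun x : X => TangentSpace (𝓡 n) x) := ⟨g.toRiemannianMetric⟩
  have hcont : IsContinuousRiemannianBundle (EuclideanSpace ℝ (Fin n))
      (fun x : X => TangentSpace (𝓡 n) x) :=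
    ⟨⟨g.inner, g.contMDiff.continuous, fun _ _ _ => rfl⟩⟩
  have : LocallyCompactSpace X := Manifold.locallyCompact_of_finiteDimensional (𝓡 n)
  refine Eq.symm (Ideal.Quotient.eq.2 fun m => ?_)
  obtain ⟨K, hK, hx⟩ := x.eventually
  have key : ∃ C : ℝ, 0 ≤ C ∧ ∀ᶠ ε : Eps in atBot, x.1 ε ∈ K →
      |u.1 ε (y.1 ε) - u.1 ε (x.1 ε)| ≤ C * (ε : ℝ) ^ m := by
    refine hK.induction_on (p := fun s => ∃ C : ℝ, 0 ≤ C ∧ ∀ᶠ ε : Eps in atBot, x.1 ε ∈ s →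
      |u.1 ε (y.1 ε) - u.1 ε (x.1 ε)| ≤ C * (ε : ℝ) ^ m) ?_ ?_ ?_ ?_
    · exact ⟨0, le_rfl, by simp⟩
    · rintro s t hst ⟨C, hC, h⟩
      exact ⟨C, hC, h.mono fun ε hε hs => hε (hst hs)⟩
    · rintro s t ⟨C, hC, h⟩ ⟨C', hC', h'⟩
      refine ⟨C + C', add_nonneg hC hC', ?_⟩
      filter_upwards [h, h'] with ε h1 h2 hst
      have hp : (0 : ℝ) ≤ (ε : ℝ) ^ m := (pow_pos ε.pos m).le
      rcases hst with hs | ht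
      · exact (h1 hs).trans (mul_le_mul_of_nonneg_right (by linarith) hp)
      · exact (h2 ht).trans (mul_le_mul_of_nonneg_right (by linarith) hp)
    · intro c _
      obtain ⟨L, δ, C, D, hL, hδ, hC, hlip⟩ := exists_lipschitz (n := n) c
      -- a common moderate bound for the derivatives along the fields `D i`
      have hmod : ∃ (N : ℕ) (B : ℝ), 0 ≤ B ∧ ∀ᶠ ε : Eps in atBot, ∀ i, ∀ z ∈ L,
          |D i (u.1 ε) z| ≤ B * ((ε : ℝ)⁻¹) ^ N := by
        have h (i : Fin n) := ModerateOn.bound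
          (u.2 L hL (D i) (Algebra.subset_adjoin (Or.inr ⟨D i, rfl⟩)))
        choose N B hB hev using h
        refine ⟨∑ i, N i, ∑ i, B i, Finset.sum_nonneg fun i _ => hB i, ?_⟩
        filter_upwards [eventually_all.2 hev] with ε hε i z hz
        have h1 : B i ≤ ∑ i, B i := Finset.single_le_sum (fun i _ => hB i) (Finset.mem_univ i)
        have h2 : N i ≤ ∑ i, N i :=
          Finset.single_le_sum (fun i _ => Nat.zero_le _) (Finset.mem_univ i)
        have h3 := pow_le_pow_right₀ ε.one_le_inv h2
        have h4 : (0 : ℝ) ≤ ((ε : ℝ)⁻¹) ^ N i := (pow_pos (inv_pos.2 ε.pos) _).le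
        exact (hε i z hz).trans (mul_le_mul h1 h3 h4 ((hB i).trans h1))
      obtain ⟨N, B, hB, hev⟩ := hmod
      obtain ⟨C', hC'⟩ := hxy (N + m + 1)
      have hsmall : ∀ᶠ ε : Eps in atBot, ENNReal.ofReal (C' * (ε : ℝ) ^ (N + m + 1)) < δ := by
        obtain ⟨r, hr0, hrδ⟩ := ENNReal.lt_iff_exists_nnreal_btwn.1 hδ
        have hr : (0 : ℝ) < r := by exact_mod_cast hr0
        have ht : 0 < min 1 (r / (|C'| + 1)) := by positivity
        refine eventually_atBot.2 ⟨⟨_, ht, min_le_left _ _⟩, fun ε hε => ?_⟩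
        have h1 : (ε : ℝ) ≤ min 1 (r / (|C'| + 1)) := hε
        refine lt_of_le_of_lt ?_ hrδ
        rw [← ENNReal.ofReal_coe_nnreal]
        refine ENNReal.ofReal_le_ofReal ?_
        have h2 : (ε : ℝ) ^ (N + m + 1) ≤ ε := by
          simpa using pow_le_pow_of_le_one ε.pos.le ε.le_one (show 1 ≤ N + m + 1 by omega)
        have hp : (0 : ℝ) ≤ (ε : ℝ) ^ (N + m + 1) := (pow_pos ε.pos _).le
        calc C' * (ε : ℝ) ^ (N + m + 1) ≤ (|C'| + 1) * ε :=
              mul_le_mul (by linarith [le_abs_self C']) h2 hp (by positivity)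
          _ ≤ (|C'| + 1) * (r / (|C'| + 1)) := by
              gcongr
              exact h1.trans (min_le_right _ _)
          _ = r := by field_simp
      refine ⟨{z | riemannianEDist (𝓡 n) c z < δ}, mem_nhdsWithin_of_mem_nhds
        (eventually_riemannianEDist_lt (𝓡 n) c hδ), C * B * |C'|, by positivity, ?_⟩
      filter_upwards [hev, hC', hsmall] with ε h1 h2 h3 h4
      have hp := ε.pos
      have h5 := hlip (u.1 ε) (B * ((ε : ℝ)⁻¹) ^ N) h1 _ _ h4 (h2.trans_lt h3)
      have h6 : ENNReal.ofReal |u.1 ε (y.1 ε) - u.1 ε (x.1 ε)| ≤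
          ENNReal.ofReal (C * (B * ((ε : ℝ)⁻¹) ^ N) * (|C'| * (ε : ℝ) ^ (N + m + 1))) := by
        rw [ENNReal.ofReal_mul (by positivity)]
        refine h5.trans (mul_le_mul_right (h2.trans (ENNReal.ofReal_le_ofReal ?_)) _)
        gcongr
        exact le_abs_self C'
      have h7 := (ENNReal.ofReal_le_ofReal_iff (by positivity)).1 h6
      refine h7.trans ?_
      have e : C * (B * ((ε : ℝ)⁻¹) ^ N) * (|C'| * (ε : ℝ) ^ (N + m + 1)) =
          C * B * |C'| * (ε : ℝ) ^ m * (((ε : ℝ)⁻¹ * ε) ^ N * ε) := by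
        rw [mul_pow, pow_add, pow_add, pow_one]
        ring
      rw [e, inv_mul_cancel₀ hp.ne', one_pow, one_mul]
      exact mul_le_of_le_one_right (by positivity) ε.le_one
  obtain ⟨C, -, hC⟩ := key
  exact ⟨C, by filter_upwards [hx, hC] with ε h1 h2 _ _ using h2 h1⟩

/-- The point value `u(x_c)`: the class of `u_ε(x_ε)`. -/
def GenFun.value [T2Space X] [ParacompactSpace X] {g : SmoothMetric n X} (u : GenFun n X)
    (xc : GenPoint g) : GenReal :=
  Quotient.lift
    (fun x : CompactNet X =>
      Quotient.lift (fun v : ModerateFun n X => GenReal.mk (netValue v x))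
        (fun _ _ h => netValue_congr_left (Submodule.quotientRel_def _ |>.1 h) x) u)
    (fun x y h => by
      obtain ⟨v, rfl⟩ := Ideal.Quotient.mk_surjective u
      exact netValue_congr_right g v h) xc

/-- Evaluation on representatives. -/
theorem GenFun.value_mk [T2Space X] [ParacompactSpace X] {g : SmoothMetric n X}
    (u : ModerateFun n X) (x : CompactNet X) :
    GenFun.value (g := g) (GenFun.mk u) (Quotient.mk (pointSetoid g) x) =
      GenReal.mk (netValue u x) := rfl

end Points

end Colombeau

end

open Filter

namespace Colombeau

/-! Both cycles are proved as 1 → 2 → 3 → 4 → 1. Point evaluation is multiplicative, which gives 1 →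
2 for invertibility. For 2 → 3, choose for each `ε` a minimizer over `K` of `|u_ε|` (resp. `u_ε`):
these points form one compactly supported net, and an invertible (resp. strictly positive)
generalized number stays above a power of `ε`. Step 3 → 4 is immediate.

The substance is 4 → 1, in two parts. First (`exists_pow_lt_of_ne_zero`), nonvanishing of all
representatives on `K` forces a power bound. Otherwise there are `ε_k → 0` and `x_k ∈ K` with
`|u_{ε_k}(x_k)| ≤ ε_k ^ k`; subtracting this value as a constant at `ε_k` is a negligible change and
produces a representative with zeros in `K` for arbitrarily small `ε`.

Second (`isUnit_mk_of_pow_lt`), power bounds on all compact sets give an inverse. Since they hold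
only for `ε` small depending on `K`, `u_ε` may have zeros for every `ε`. One inverts instead `w_ε =
u_ε² + exp(-1/ε)`, which is positive everywhere and represents `u²`; then `u / w` inverts `u`.
Moderateness of `v = 1/w` (`IsModerate.of_mul_eq_one`) comes from `D v = -v² D w`: all derivatives
of `v` are polynomials in `v` and moderate nets.

For strict positivity, nonnegative representatives supply the sign in 1 → 2 and are recovered in 4 →
1 by changing a net away from small `ε`. -/

/-! ### Asymptotics of nets and lower bounds for generalized numbers -/

theorem eventually_iff_exists_lt {p : Eps → Prop} :
    (∀ᶠ ε in atBot, p ε) ↔ ∃ ε₀ : Eps, ∀ ε < ε₀, p ε := by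
  constructor
  · intro h
    obtain ⟨ε₀, h⟩ := eventually_atBot.1 h
    exact ⟨ε₀, fun ε hε => h ε hε.le⟩
  · rintro ⟨ε₀, h⟩
    have hpos : (0 : ℝ) < ε₀ / 2 := half_pos ε₀.pos
    refine eventually_atBot.2 ⟨⟨ε₀ / 2, hpos, by linarith [ε₀.le_one]⟩, fun ε hε => h ε ?_⟩
    have h1 : (ε : ℝ) ≤ ε₀ / 2 := hε
    exact Subtype.coe_lt_coe.1 (by linarith)

/-- Used to absorb multiplicative constants at the cost of one power of `ε`. -/
theorem eventually_mul_lt_one (C : ℝ) : ∀ᶠ ε : Eps in atBot, C * ε < 1 := by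
  have hc : 0 < |C| + 1 := by positivity
  refine eventually_iff_exists_lt.2
    ⟨⟨(|C| + 1)⁻¹, inv_pos.2 hc, inv_le_one_of_one_le₀ (by linarith [abs_nonneg C])⟩,
      fun ε hε => ?_⟩
  have h1 : (ε : ℝ) < (|C| + 1)⁻¹ := hε
  calc C * ε ≤ (|C| + 1) * ε :=
        mul_le_mul_of_nonneg_right (by linarith [le_abs_self C]) ε.pos.le
    _ < (|C| + 1) * (|C| + 1)⁻¹ := by gcongr
    _ = 1 := mul_inv_cancel₀ hc.ne'

theorem isNegligibleNum_iff {a : Eps → ℝ} :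
    IsNegligibleNum a ↔ ∀ m : ℕ, ∃ C : ℝ, ∀ᶠ ε : Eps in atBot, |a ε| ≤ C * (ε : ℝ) ^ m := by
  simp [IsNegligibleNum, NegligibleOn]

/-- Negligible nets are eventually below every power of `ε`. -/
theorem NegligibleOn.eventually_le_pow {S : Type*} {A : Set S} {a : Eps → S → ℝ}
    (ha : NegligibleOn A a) (m : ℕ) :
    ∀ᶠ ε : Eps in atBot, ∀ x ∈ A, |a ε x| ≤ (ε : ℝ) ^ m := by
  obtain ⟨C, h⟩ := ha (m + 1)
  filter_upwards [h, eventually_mul_lt_one C] with ε h1 h2 x hx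
  refine (h1 x hx).trans ?_
  rw [pow_succ', ← mul_assoc]
  exact mul_le_of_le_one_left (pow_pos ε.pos m).le h2.le

theorem NegligibleOn.moderateOn {S : Type*} {A : Set S} {a : Eps → S → ℝ}
    (ha : NegligibleOn A a) : ModerateOn A a := by
  obtain ⟨C, h⟩ := ha 0
  exact ⟨0, C, by simpa using h⟩

/-- A net of numbers which is invertible modulo negligible nets is bounded below by a power
of `ε`. -/
theorem exists_pow_lt_abs_of_isUnit {a : ModerateNum} (ha : IsUnit (GenReal.mk a)) :
    ∃ m : ℕ, ∀ᶠ ε : Eps in atBot, (ε : ℝ) ^ m < |a.1 ε| := by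
  obtain ⟨c, hc⟩ := isUnit_iff_exists_inv.1 ha
  obtain ⟨b, rfl⟩ := Ideal.Quotient.mk_surjective c
  have hab : a * b - 1 ∈ NegligibleNum :=
    Ideal.Quotient.eq.1 (by rw [map_mul, map_one]; exact hc)
  obtain ⟨N, C, hC, hb⟩ := ModerateOn.bound b.2
  -- From `|a b| > 1/2` and `|b| ≤ C ε⁻ᴺ`, a bound `|a| ≤ ε ^ (N + 1)` would give `1/2 < C ε`; the
  -- extra power makes this fail for small `ε`.
  refine ⟨N + 1, ?_⟩
  have hab' : NegligibleOn (Set.univ : Set Unit) fun ε _ => a.1 ε * b.1 ε - 1 := hab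
  filter_upwards [hb, hab'.eventually_le_pow 1, eventually_mul_lt_one 2,
    eventually_mul_lt_one (2 * C)] with ε h1 h2 h3 h4
  replace h1 : |b.1 ε| ≤ C * ((ε : ℝ)⁻¹) ^ N := h1 () trivial
  replace h2 : |a.1 ε * b.1 ε - 1| ≤ (ε : ℝ) ^ 1 := h2 () trivial
  have hε := ε.pos
  have hp : (0 : ℝ) < (ε : ℝ) ^ N := pow_pos hε N
  have h5 : 1 / 2 < |a.1 ε| * |b.1 ε| := by
    rw [← abs_mul]
    have := (abs_le.1 h2).1
    have := le_abs_self (a.1 ε * b.1 ε)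
    linarith
  by_contra! h6
  have h7 : |a.1 ε| * |b.1 ε| ≤ (ε : ℝ) ^ (N + 1) * (C * ((ε : ℝ)⁻¹) ^ N) :=
    mul_le_mul h6 h1 (abs_nonneg _) (by positivity)
  have h8 : (ε : ℝ) ^ (N + 1) * (C * ((ε : ℝ)⁻¹) ^ N) = C * ε := by
    rw [pow_succ, inv_pow]
    field_simp
  linarith

/-- Every representative of a strictly positive number is bounded below by a power of `ε`. -/
theorem GenReal.StrictlyPositive.exists_pow_lt {a : ModerateNum}
    (ha : (GenReal.mk a).StrictlyPositive) :
    ∃ m : ℕ, ∀ᶠ ε : Eps in atBot, (ε : ℝ) ^ m < a.1 ε := by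
  obtain ⟨b, hb, m, hm⟩ := ha
  have hba : NegligibleOn (Set.univ : Set Unit) fun ε _ => b.1 ε - a.1 ε :=
    (Ideal.Quotient.eq.1 hb : b - a ∈ NegligibleNum)
  -- The positive representative is at least `ε ^ m > 2 ε ^ (m + 1)`, and passing to `a` costs at
  -- most `ε ^ (m + 1)`.
  refine ⟨m + 1, ?_⟩
  filter_upwards [hba.eventually_le_pow (m + 1), eventually_iff_exists_lt.2 hm,
    eventually_mul_lt_one 2] with ε h1 h2 h3
  replace h1 : |b.1 ε - a.1 ε| ≤ (ε : ℝ) ^ (m + 1) := h1 () trivial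
  have h4 := le_abs_self (b.1 ε - a.1 ε)
  have h5 : 2 * (ε : ℝ) ^ (m + 1) < (ε : ℝ) ^ m := by
    rw [pow_succ', ← mul_assoc]
    exact mul_lt_of_lt_one_left (pow_pos ε.pos m) h3
  linarith

/-- The numbers `exp (-1/ε)` form a negligible net. -/
theorem isNegligibleNum_exp_neg_inv : IsNegligibleNum fun ε => Real.exp (-(ε : ℝ)⁻¹) := by
  refine isNegligibleNum_iff.2 fun m => ⟨m.factorial, Eventually.of_forall fun ε => ?_⟩
  have hε := ε.pos
  rw [Real.abs_exp, Real.exp_neg]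
  -- One term of the exponential series at `1/ε` yields the constant `m!`.
  have h := Real.pow_div_factorial_le_exp ((ε : ℝ)⁻¹) (inv_pos.2 hε).le m
  have h2 : (0 : ℝ) < ((ε : ℝ)⁻¹) ^ m / m.factorial := by positivity
  refine (inv_anti₀ h2 h).trans (le_of_eq ?_)
  rw [inv_div, inv_pow, div_inv_eq_mul]

theorem lt_of_coe_lt_iInf {X : Type*} {K : Set X} {f : X → ℝ} {a : ℝ}
    (h : (a : EReal) < ⨅ x ∈ K, ((f x : ℝ) : EReal)) {x : X} (hx : x ∈ K) : a < f x :=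
  EReal.coe_lt_coe_iff.1 (h.trans_le (iInf₂_le x hx))

/-! ### Moderate reciprocals and invertibility from power bounds -/

section Algebra

variable {n : ℕ} {X : Type*} [TopologicalSpace X] [ChartedSpace (EuclideanSpace ℝ (Fin n)) X]

theorem IsModerate.apply_diffOp {u : Eps → Smooth n X} (hu : IsModerate u)
    {P : Module.End ℝ (Smooth n X)} (hP : P ∈ DiffOp n X) : IsModerate fun ε => P (u ε) :=
  fun K hK Q hQ => hu K hK (Q * P) (mul_mem hQ hP)

theorem IsNegligible.isModerate {u : Eps → Smooth n X} (hu : IsNegligible u) : IsModerate u :=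
  fun K hK P hP => (hu K hK P hP).moderateOn

/-- A net which vanishes for small `ε` is negligible. -/
theorem isNegligible_of_eventually_eq_zero {u : Eps → Smooth n X}
    (hu : ∀ᶠ ε in atBot, u ε = 0) : IsNegligible u := by
  refine fun K _ P _ m => ⟨0, hu.mono fun ε hε x _ => ?_⟩
  simp [hε]

/-- A negligible net of constants is a negligible net of functions. -/
theorem IsNegligibleNum.isNegligible {c : Eps → ℝ} (hc : IsNegligibleNum c) :
    IsNegligible fun ε => c ε • (1 : Smooth n X) := by
  intro K hK P hP m
  obtain ⟨M, hM⟩ := hK.exists_bound_of_continuousOn (f := fun x => P (1 : Smooth n X) x)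
    (P 1).contMDiff.continuous.continuousOn
  obtain ⟨C, hC⟩ := isNegligibleNum_iff.1 hc m
  refine ⟨C * M, hC.mono fun ε hε x hx => ?_⟩
  have h1 : P (c ε • (1 : Smooth n X)) x = c ε * P (1 : Smooth n X) x := by
    rw [map_smul]; rfl
  change |P (c ε • (1 : Smooth n X)) x| ≤ _
  rw [h1, abs_mul]
  have h2 : |P (1 : Smooth n X) x| ≤ M := hM x hx
  calc |c ε| * |P (1 : Smooth n X) x| ≤ (C * (ε : ℝ) ^ m) * M :=
        mul_le_mul hε h2 (abs_nonneg _) ((abs_nonneg _).trans hε)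
    _ = C * M * (ε : ℝ) ^ m := by ring

/-- The reciprocal of a nowhere vanishing smooth function. -/
noncomputable def smoothInv (w : Smooth n X) (hw : ∀ x, w x ≠ 0) : Smooth n X :=
  ⟨fun x => (w x)⁻¹, w.contMDiff.inv₀ hw⟩

theorem mul_smoothInv (w : Smooth n X) (hw : ∀ x, w x ≠ 0) : w * smoothInv w hw = 1 := by
  ext x
  exact mul_inv_cancel₀ (hw x)

/-- A multiplicative inverse of a moderate net which is bounded by powers of `ε⁻¹` on compact sets
is moderate. -/
theorem IsModerate.of_mul_eq_one {w v : Eps → Smooth n X} (hw : IsModerate w)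
    (hwv : w * v = 1) (hv : ∀ K : Set X, IsCompact K → ModerateOn K fun ε x => v ε x) :
    IsModerate v := by
  -- `B` avoids formulas for higher derivatives: its elements satisfy zeroth-order bounds (`hB`) and
  -- it is stable under every differential operator (`hP`), so all derivatives of `v` are bounded as
  -- required.
  let B : Subring (Eps → Smooth n X) := Subring.closure (insert v {z | IsModerate z})
  have hmod {z : Eps → Smooth n X} (hz : IsModerate z) : z ∈ B :=
    Subring.subset_closure (Or.inr hz)
  have hvB : v ∈ B := Subring.subset_closure (Or.inl rfl)
  have hB (z : Eps → Smooth n X) (hz : z ∈ B) (K : Set X) (hK : IsCompact K) :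
      ModerateOn K fun ε x => z ε x := by
    induction hz using Subring.closure_induction with
    | mem z hz =>
      rcases hz with rfl | hz
      · exact hv K hK
      · exact hz K hK 1 (one_mem _)
    | zero => exact negligibleOn_zero.moderateOn
    | one => exact moderateOn_of_bounded (c := fun _ => 1) (M := 1) (by simp)
    | add a b _ _ ha hb => exact ha.add hb
    | neg a _ ha => exact ha.neg
    | mul a b _ _ ha hb => exact ha.mul hb
  have hD (D : Derivation ℝ (Smooth n X) (Smooth n X)) (z : Eps → Smooth n X) (hz : z ∈ B) :
      (fun ε => D (z ε)) ∈ B := by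
    induction hz using Subring.closure_induction with
    | mem z hz =>
      rcases hz with rfl | hz
      -- Here `z` is `v`: differentiate `w z = 1` and multiply by `z`.
      · have e : (fun ε => D (z ε)) = -(z * z * fun ε => D (w ε)) := by
          funext ε
          have h1 : w ε * z ε = 1 := congrFun hwv ε
          have h2 : w ε * D (z ε) + z ε * D (w ε) = 0 := by
            have := D.leibniz (w ε) (z ε)
            rw [h1, D.map_one_eq_zero] at this
            exact this.symm
          change D (z ε) = -(z ε * z ε * D (w ε))
          linear_combination z ε * h2 - D (z ε) * h1
        rw [e]
        exact neg_mem (mul_mem (mul_mem hvB hvB)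
          (hmod (hw.apply_diffOp (Algebra.subset_adjoin (Or.inr ⟨D, rfl⟩)))))
      · exact hmod (hz.apply_diffOp (Algebra.subset_adjoin (Or.inr ⟨D, rfl⟩)))
    | zero =>
      have e : (fun ε : Eps => D ((0 : Eps → Smooth n X) ε)) = 0 := by
        funext ε; simp
      rw [e]; exact zero_mem _
    | one =>
      have e : (fun ε : Eps => D ((1 : Eps → Smooth n X) ε)) = 0 := by
        funext ε; simp
      rw [e]; exact zero_mem _
    | add a b _ _ ha hb =>
      have e : (fun ε : Eps => D ((a + b) ε)) = (fun ε => D (a ε)) + fun ε => D (b ε) := by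
        funext ε; simp
      rw [e]; exact add_mem ha hb
    | neg a _ ha =>
      have e : (fun ε : Eps => D ((-a) ε)) = -(fun ε => D (a ε)) := by
        funext ε; simp
      rw [e]; exact neg_mem ha
    | mul a b ha' hb' ha hb =>
      have e : (fun ε : Eps => D ((a * b) ε)) =
          (a * fun ε => D (b ε)) + b * fun ε => D (a ε) := by
        funext ε; simp
      rw [e]; exact add_mem (mul_mem ha' hb) (mul_mem hb' ha)
  have hP (P : Module.End ℝ (Smooth n X)) (hP : P ∈ DiffOp n X) :
      ∀ z ∈ B, (fun ε => P (z ε)) ∈ B := by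
    refine Algebra.adjoin_induction (p := fun P _ => ∀ z ∈ B, (fun ε => P (z ε)) ∈ B)
      ?_ ?_ ?_ ?_ hP
    · rintro _ (⟨f, rfl⟩ | ⟨D, rfl⟩) z hz
      · exact mul_mem (hmod (IsModerate.const f)) hz
      · exact hD D z hz
    · intro r z hz
      have e : (fun ε => (algebraMap ℝ (Module.End ℝ (Smooth n X)) r) (z ε)) =
          (fun _ => r • (1 : Smooth n X)) * z := by
        funext ε; simp [Module.algebraMap_end_apply]
      rw [e]
      exact mul_mem (hmod (IsModerate.const _)) hz
    · intro P Q _ _ hP hQ z hz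
      exact add_mem (hP z hz) (hQ z hz)
    · intro P Q _ _ hP hQ z hz
      exact hP _ (hQ z hz)
  exact fun K hK P h => hB _ (hP P h v hvB) K hK

/-- A net which is bounded below by a power of `ε` on each compact set is invertible. -/
theorem isUnit_mk_of_pow_lt {r : ModerateFun n X}
    (hr : ∀ K : Set X, IsCompact K →
      ∃ m : ℕ, ∀ᶠ ε : Eps in atBot, ∀ x ∈ K, (ε : ℝ) ^ m < |r.1 ε x|) :
    IsUnit (GenFun.mk r) := by
  -- A negligible net of positive constants: added to `r²`, it removes all zeros, for every `ε` and
  -- on all of `X`, without changing the class.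
  let d : Eps → Smooth n X := fun ε => Real.exp (-(ε : ℝ)⁻¹) • 1
  have hd : IsNegligible d := isNegligibleNum_exp_neg_inv.isNegligible
  have hdx (ε : Eps) (x : X) : 0 < d ε x := by
    have : d ε x = Real.exp (-(ε : ℝ)⁻¹) * 1 := rfl
    rw [this, mul_one]
    exact Real.exp_pos _
  let D : ModerateFun n X := ⟨d, hd.isModerate⟩
  let W : ModerateFun n X := r * r + D
  have hWx (ε : Eps) (x : X) : W.1 ε x = r.1 ε x * r.1 ε x + d ε x := rfl
  have hW0 (ε : Eps) (x : X) : 0 < W.1 ε x := by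
    rw [hWx]
    exact add_pos_of_nonneg_of_pos (mul_self_nonneg _) (hdx ε x)
  let v : Eps → Smooth n X := fun ε => smoothInv (W.1 ε) fun x => (hW0 ε x).ne'
  have hWv : W.1 * v = 1 := funext fun ε => mul_smoothInv _ _
  have hv : IsModerate v := by
    refine IsModerate.of_mul_eq_one W.2 hWv fun K hK => ?_
    obtain ⟨m, hm⟩ := hr K hK
    -- On `K`, `W ≥ r² ≥ ε ^ (2m)` for small `ε`.
    refine ⟨m + m, 1, hm.mono fun ε hε x hx => ?_⟩
    have hp : (0 : ℝ) < (ε : ℝ) ^ m := pow_pos ε.pos m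
    have h1 : (ε : ℝ) ^ (m + m) ≤ W.1 ε x := by
      rw [hWx, pow_add, ← abs_mul_abs_self (r.1 ε x)]
      have := mul_le_mul (hε x hx).le (hε x hx).le hp.le (abs_nonneg _)
      linarith [hdx ε x]
    change |(W.1 ε x)⁻¹| ≤ _
    rw [abs_of_pos (inv_pos.2 (hW0 ε x)), one_mul, inv_pow]
    exact inv_anti₀ (pow_pos ε.pos _) h1
  let V : ModerateFun n X := ⟨v, hv⟩
  have hWV : W * V = 1 := Subtype.ext hWv
  have hD : GenFun.mk D = 0 := Ideal.Quotient.eq_zero_iff_mem.2 hd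
  -- `r (r V) + D V = W V = 1`, and `D` has class zero.
  refine IsUnit.of_mul_eq_one (GenFun.mk (r * V)) ?_
  have h1 : GenFun.mk r * GenFun.mk (r * V) + GenFun.mk D * GenFun.mk V = GenFun.mk (W * V) := by
    simp only [GenFun.mk, ← map_mul, ← map_add]
    congr 1
    simp only [W]
    ring
  rw [hD, zero_mul, add_zero, hWV] at h1
  exact h1.trans (map_one _)

/-! ### From nonvanishing of all representatives to a power bound -/

/-- If no representative of the class of `r` has zeros on `K` for arbitrarily small `ε`, then `r` is
bounded below on `K` by a power of `ε`. -/
theorem exists_pow_lt_of_ne_zero {K : Set X} (r : ModerateFun n X)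
    (h : ∀ s : ModerateFun n X, GenFun.mk s = GenFun.mk r →
      ∀ᶠ ε : Eps in atBot, ∀ x ∈ K, s.1 ε x ≠ 0) :
    ∃ m : ℕ, ∀ᶠ ε : Eps in atBot, ∀ x ∈ K, (ε : ℝ) ^ m < |r.1 ε x| := by
  by_contra! H
  -- The condition `(k + 1) ε < 1` makes the chosen parameters tend to `0`.
  have H' (k : ℕ) : ∃ (ε : Eps) (x : X), (k + 1 : ℝ) * ε < 1 ∧ x ∈ K ∧
      |r.1 ε x| ≤ (ε : ℝ) ^ k := by
    obtain ⟨ε, ⟨x, hx, hle⟩, hε⟩ := ((H k).and_eventually (eventually_mul_lt_one _)).exists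
    exact ⟨ε, x, hε, hx, hle⟩
  choose e x he hx hle using H'
  classical
  -- The sequence `e` need not be injective, so one index is chosen for each value it takes.
  let c : Eps → ℝ := fun ε => if h : ∃ k, e k = ε then r.1 ε (x h.choose) else 0
  have hc : IsNegligibleNum c := by
    refine isNegligibleNum_iff.2 fun m => ⟨1, ?_⟩
    -- Below `e 0, …, e (m - 1)`, any index `k` with `e k = ε` satisfies `k ≥ m`, so `|c ε| ≤ ε ^ k
    -- ≤ ε ^ m`.
    have hsmall : ∀ᶠ ε : Eps in atBot, ∀ k ∈ Finset.range m, ε < e k :=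
      (Finset.eventually_all _).2 fun k _ => eventually_iff_exists_lt.2 ⟨e k, fun _ h => h⟩
    filter_upwards [hsmall] with ε hε
    rw [one_mul]
    by_cases hk : ∃ k, e k = ε
    · have hkc := hk.choose_spec
      have hmk : m ≤ hk.choose := by
        by_contra! hlt
        exact (hε _ (Finset.mem_range.2 hlt)).ne hkc.symm
      simp only [c, dif_pos hk]
      have := hle hk.choose
      rw [hkc] at this
      exact this.trans (pow_le_pow_of_le_one ε.pos.le ε.le_one hmk)
    · simp only [c, dif_neg hk, abs_zero]
      exact (pow_pos ε.pos m).le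
  let Z : ModerateFun n X := ⟨_, (IsNegligibleNum.isNegligible (n := n) (X := X) hc).isModerate⟩
  have hZ : GenFun.mk (r - Z) = GenFun.mk r := by
    refine Ideal.Quotient.eq.2 ?_
    rw [sub_sub_cancel_left]
    exact neg_mem (show Z ∈ NegligibleFun n X from hc.isNegligible)
  obtain ⟨ε₀, hε₀⟩ := eventually_iff_exists_lt.1 (h _ hZ)
  obtain ⟨k, hk⟩ := exists_nat_gt ((ε₀ : ℝ)⁻¹)
  have hlt : e k < ε₀ := by
    refine Subtype.coe_lt_coe.1 ?_
    have h0 := ε₀.pos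
    have h1 : 1 < k * (ε₀ : ℝ) := by
      have := mul_lt_mul_of_pos_right hk h0
      rwa [inv_mul_cancel₀ h0.ne'] at this
    have h2 := he k
    have h3 := (e k).pos
    by_contra! h4
    have := mul_le_mul_of_nonneg_left h4 (Nat.cast_nonneg (α := ℝ) k)
    nlinarith
  -- The zero produced at `e k` lies at the point whose index was selected in `c`, which may differ
  -- from `x k`.
  have hex : ∃ j, e j = e k := ⟨k, rfl⟩
  refine hε₀ (e k) hlt (x hex.choose) (hx _) ?_
  change r.1 (e k) (x hex.choose) - c (e k) * 1 = 0
  simp only [c, dif_pos hex]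
  ring

/-! ### Point values, minimizing nets and nonnegative representatives -/

/-- Evaluation along a net of points is multiplicative and respects negligibility, so a
representative of the inverse function evaluates to an inverse number. -/
theorem netValue_isUnit_of_isUnit [IsManifold (𝓡 n) ∞ X] {r : ModerateFun n X} (hr : IsUnit (GenFun.mk r))
    (x : CompactNet X) : IsUnit (GenReal.mk (netValue r x)) := by
  obtain ⟨c, hc⟩ := isUnit_iff_exists_inv.1 hr
  obtain ⟨s, rfl⟩ := Ideal.Quotient.mk_surjective c
  have h : r * s - 1 ∈ NegligibleFun n X :=
    Ideal.Quotient.eq.1 (by rw [map_mul, map_one]; exact hc)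
  refine IsUnit.of_mul_eq_one (GenReal.mk (netValue s x)) ?_
  have h1 := netValue_congr_left h x
  have h2 : netValue (r * s) x = netValue r x * netValue s x := rfl
  have h3 : netValue (1 : ModerateFun n X) x = 1 := rfl
  rw [h2, h3] at h1
  simpa only [GenReal.mk, map_mul, map_one] using h1

/-- Points of a compact set at which a net of continuous functions is minimal. -/
theorem exists_compactNet_forall_le {K : Set X} (hK : IsCompact K) (hne : K.Nonempty)
    {f : Eps → X → ℝ} (hf : ∀ ε, Continuous (f ε)) :
    ∃ x : CompactNet X, ∀ ε, ∀ y ∈ K, f ε (x.1 ε) ≤ f ε y := by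
  -- Nets of points carry no regularity in `ε`, so arbitrary minimizers may be chosen.
  choose x hx hmin using fun ε => hK.exists_isMinOn hne (hf ε).continuousOn
  exact ⟨⟨x, K, hK, ⟨1, one_pos, le_rfl⟩, fun ε _ => hx ε⟩, fun ε y hy => hmin ε hy⟩

/-- A net which is positive at all compactly supported points with a lower bound by a power of `ε`
has such a lower bound for its infimum on compact sets. -/
theorem exists_pow_lt_iInf {K : Set X} (hK : IsCompact K) {f : Eps → X → ℝ}
    (hf : ∀ ε, Continuous (f ε))
    (h : ∀ x : CompactNet X, ∃ m : ℕ, ∀ᶠ ε : Eps in atBot, (ε : ℝ) ^ m < f ε (x.1 ε)) :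
    ∃ (ε₀ : Eps) (m : ℕ), ∀ ε < ε₀,
      (((ε : ℝ) ^ m : ℝ) : EReal) < ⨅ x ∈ K, ((f ε x : ℝ) : EReal) := by
  rcases K.eq_empty_or_nonempty with rfl | hne
  -- Over the empty set the infimum is `⊤`, so any exponent works.
  · exact ⟨⟨1, one_pos, le_rfl⟩, 0, fun ε _ => by simpa using EReal.coe_lt_top 1⟩
  · obtain ⟨x, hx⟩ := exists_compactNet_forall_le hK hne hf
    obtain ⟨m, hm⟩ := h x
    obtain ⟨ε₀, hε₀⟩ := eventually_iff_exists_lt.1 hm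
    exact ⟨ε₀, m, fun ε hε => (EReal.coe_lt_coe_iff.2 (hε₀ ε hε)).trans_le
      (le_iInf₂ fun y hy => EReal.coe_le_coe_iff.2 (hx ε y hy))⟩

/-- A representative which is positive on `K` for small `ε` can be changed into one which is
nonnegative on `K` for all `ε`. -/
theorem exists_nonneg_representative {K : Set X} (r : ModerateFun n X)
    (h : ∀ᶠ ε : Eps in atBot, ∀ x ∈ K, 0 ≤ r.1 ε x) :
    ∃ s : ModerateFun n X, GenFun.mk s = GenFun.mk r ∧ ∀ ε : Eps, ∀ x ∈ K, 0 ≤ s.1 ε x := by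
  classical
  -- Subtracting `d` replaces `r ε` by zero exactly where it takes a negative value on `K`, which
  -- does not happen for small `ε`.
  let d : Eps → Smooth n X := fun ε => if ∀ x ∈ K, 0 ≤ r.1 ε x then 0 else r.1 ε
  have hd : IsNegligible d :=
    isNegligible_of_eventually_eq_zero (h.mono fun ε hε => if_pos hε)
  let D : ModerateFun n X := ⟨d, hd.isModerate⟩
  refine ⟨r - D, Ideal.Quotient.eq.2 ?_, fun ε x hx => ?_⟩
  · rw [sub_sub_cancel_left]
    exact neg_mem (show D ∈ NegligibleFun n X from hd)
  · change 0 ≤ (r.1 ε - d ε) x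
    by_cases hε : ∀ x ∈ K, 0 ≤ r.1 ε x
    · simpa only [d, if_pos hε, sub_zero] using hε x hx
    · simp only [d, if_neg hε, sub_self]
      exact le_rfl

end Algebra

end Colombeau

/-! ### The two cycles of implications -/

open Colombeau in
theorem mainTheorem7 {n : ℕ} {X : Type*} [TopologicalSpace X]
    [ChartedSpace (EuclideanSpace ℝ (Fin n)) X] [IsManifold (𝓡 n) ∞ X]
    [T2Space X] [ParacompactSpace X]
    (g : Colombeau.SmoothMetric n X) (u : Colombeau.GenFun n X) :
    [ IsUnit u,
      ∀ xc : Colombeau.GenPoint g, IsUnit (u.value xc),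
      ∀ r : Colombeau.ModerateFun n X, Colombeau.GenFun.mk r = u →
        ∀ K : Set X, IsCompact K → ∃ (ε₀ : Colombeau.Eps) (m : ℕ), ∀ ε < ε₀,
          (((ε : ℝ) ^ m : ℝ) : EReal) < ⨅ x ∈ K, ((|r.1 ε x| : ℝ) : EReal),
      ∀ r : Colombeau.ModerateFun n X, Colombeau.GenFun.mk r = u →
        ∀ K : Set X, IsCompact K → ∃ ε₀ : Colombeau.Eps, ∀ x ∈ K, ∀ ε < ε₀,
          r.1 ε x ≠ 0 ].TFAE ∧
    [ u.StrictlyPositive,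
      ∀ xc : Colombeau.GenPoint g, (u.value xc).StrictlyPositive,
      ∀ r : Colombeau.ModerateFun n X, Colombeau.GenFun.mk r = u →
        ∀ K : Set X, IsCompact K → ∃ (ε₀ : Colombeau.Eps) (m : ℕ), ∀ ε < ε₀,
          (((ε : ℝ) ^ m : ℝ) : EReal) < ⨅ x ∈ K, ((r.1 ε x : ℝ) : EReal),
      ∀ r : Colombeau.ModerateFun n X, Colombeau.GenFun.mk r = u →
        ∀ K : Set X, IsCompact K → ∃ ε₀ : Colombeau.Eps, ∀ x ∈ K, ∀ ε < ε₀,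
          0 < r.1 ε x ].TFAE := by
  have cont (r : ModerateFun n X) (ε : Eps) : Continuous fun x => r.1 ε x :=
    (r.1 ε).contMDiff.continuous
  have unit_lower (r : ModerateFun n X) (hr : ∀ x : CompactNet X,
      IsUnit (GenReal.mk (netValue r x))) (K : Set X) (hK : IsCompact K) :
      ∃ (ε₀ : Eps) (m : ℕ), ∀ ε < ε₀,
        (((ε : ℝ) ^ m : ℝ) : EReal) < ⨅ x ∈ K, ((|r.1 ε x| : ℝ) : EReal) :=
    exists_pow_lt_iInf (f := fun ε x => |r.1 ε x|) hK (fun ε => (cont r ε).abs)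
      fun x => exists_pow_lt_abs_of_isUnit (hr x)
  -- Serves 4 → 1 in both cycles, as positivity implies nonvanishing. The hypothesis on all
  -- representatives is needed, since the argument perturbs the given one.
  have lower (h : ∀ r : ModerateFun n X, GenFun.mk r = u → ∀ K : Set X, IsCompact K →
      ∃ ε₀ : Eps, ∀ x ∈ K, ∀ ε < ε₀, r.1 ε x ≠ 0) : IsUnit u := by
    obtain ⟨r, rfl⟩ := Ideal.Quotient.mk_surjective u
    refine isUnit_mk_of_pow_lt fun K hK => exists_pow_lt_of_ne_zero r fun s hs => ?_
    obtain ⟨ε₀, hε₀⟩ := h s hs K hK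
    exact eventually_iff_exists_lt.2 ⟨ε₀, fun ε hε x hx => hε₀ x hx ε hε⟩
  constructor
  · tfae_have 1 → 2 := by
      rintro h ⟨x⟩
      obtain ⟨r, rfl⟩ := Ideal.Quotient.mk_surjective u
      exact netValue_isUnit_of_isUnit h x
    tfae_have 2 → 3 := by
      rintro h r rfl K hK
      exact unit_lower r (fun x => h (Quotient.mk (pointSetoid g) x)) K hK
    tfae_have 3 → 4 := by
      intro h r hr K hK
      obtain ⟨ε₀, m, hm⟩ := h r hr K hK
      exact ⟨ε₀, fun x hx ε hε =>
        abs_pos.1 ((pow_pos ε.pos m).trans (lt_of_coe_lt_iInf (hm ε hε) hx))⟩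
    tfae_have 4 → 1 := lower
    tfae_finish
  · tfae_have 1 → 2 := by
      rintro ⟨hu, hpos⟩ ⟨x⟩
      obtain ⟨K, hK, hx⟩ := x.eventually
      obtain ⟨r, rfl, hr⟩ := hpos K hK
      obtain ⟨m, hm⟩ := exists_pow_lt_abs_of_isUnit (netValue_isUnit_of_isUnit hu x)
      obtain ⟨ε₀, hε₀⟩ := eventually_iff_exists_lt.1 (hm.and hx)
      refine ⟨netValue r x, rfl, m, ε₀, fun ε hε => ?_⟩
      obtain ⟨h1, h2⟩ := hε₀ ε hε
      exact h1.le.trans_eq (abs_of_nonneg (hr ε _ h2))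
    tfae_have 2 → 3 := by
      rintro h r rfl K hK
      exact exists_pow_lt_iInf hK (cont r) fun x =>
        GenReal.StrictlyPositive.exists_pow_lt (h (Quotient.mk (pointSetoid g) x))
    tfae_have 3 → 4 := by
      intro h r hr K hK
      obtain ⟨ε₀, m, hm⟩ := h r hr K hK
      exact ⟨ε₀, fun x hx ε hε => (pow_pos ε.pos m).trans (lt_of_coe_lt_iInf (hm ε hε) hx)⟩
    tfae_have 4 → 1 := by
      intro h
      refine ⟨lower fun r hr K hK => ?_, fun K hK => ?_⟩
      · obtain ⟨ε₀, hε₀⟩ := h r hr K hK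
        exact ⟨ε₀, fun x hx ε hε => (hε₀ x hx ε hε).ne'⟩
      · obtain ⟨r, hr⟩ := Ideal.Quotient.mk_surjective u
        obtain ⟨ε₀, hε₀⟩ := h r hr K hK
        obtain ⟨s, hs, hpos⟩ := exists_nonneg_representative r
          (eventually_iff_exists_lt.2 ⟨ε₀, fun ε hε x hx => (hε₀ x hx ε hε).le⟩)
        exact ⟨s, hs.trans hr, hpos⟩
    tfae_finish
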